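/- Let $n,t\ge 1$ be integers and let $\mathbf F$ be a symmetric $t\times t$ matrix with entries in $\mathbb R[X]=\mathbb R[X_1,\dots,X_n]$, of degree $d>0$; that is, writing $\mathbf F=\sum_{\alpha\in\mathbb N_0^n}\mathbf F_\alpha X^\alpha$ with real $t\times t$ matrices $\mathbf F_\alpha$, we have $\mathbf F_\alpha=0$ whenever $|\alpha|>d$, and $\mathbf F_\alpha\neq0$ for some $\alpha$ with $|\alpha|=d$, where $|\alpha|=\alpha_1+\dots+\alpha_n$. Put $$l_{2i-1}=1+X_i,\qquad l_{2i}=1-X_i\qquad(i=1,\dots,n).$$ If the real matrix $\mathbf F(x)$ is positive definite for every $x\in[-1,1]^n$, then there exist a positive integer $N$ and, for every $\alpha\in\mathbb N_0^{2n}$ with $|\alpha|\le N+d$, a (symmetric) positive definite matrix $\mathbf G_\alpha\in M_t(\mathbb R)$ such that $$\mathbf F(X)=\sum_{\substack{\alpha\in\mathbb N_0^{2n}\\ |\alpha|\le N+d}}\mathbf G_\alpha\, l_1^{\alpha_1}l_2^{\alpha_2}\cdots l_{2n-1}^{\alpha_{2n-1}}l_{2n}^{\alpha_{2n}}.$$ 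-/

import Mathlib

/-- The coefficient `F_α` of the monomial `X ^ α` in a matrix polynomial `F = ∑ F_α X ^ α`. -/
noncomputable def matrixCoeff {n t : ℕ} (F : Matrix (Fin t) (Fin t) (MvPolynomial (Fin n) ℝ))
    (α : Fin n →₀ ℕ) : Matrix (Fin t) (Fin t) ℝ :=
  F.map fun p => MvPolynomial.coeff α p

/-- `F` is a matrix polynomial of degree `d`: it has no terms of total degree greater than `d`,
and its homogeneous part of degree `d` is not zero. -/
def HasMatrixDegree {n t : ℕ} (F : Matrix (Fin t) (Fin t) (MvPolynomial (Fin n) ℝ))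
    (d : ℕ) : Prop :=
  (∀ α : Fin n →₀ ℕ, d < α.degree → matrixCoeff F α = 0) ∧
    ∃ α : Fin n →₀ ℕ, α.degree = d ∧ matrixCoeff F α ≠ 0

/-- The value `F(x)` of a matrix polynomial at a point. -/
noncomputable def matrixEval {n t : ℕ} (F : Matrix (Fin t) (Fin t) (MvPolynomial (Fin n) ℝ))
    (x : Fin n → ℝ) : Matrix (Fin t) (Fin t) ℝ :=
  F.map fun p => MvPolynomial.eval x p

/-- The linear polynomials `1 + X₁, 1 - X₁, …, 1 + Xₙ, 1 - Xₙ`, in this order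
(indices start at `0` in the code). -/
noncomputable def cubeForm (n : ℕ) (j : Fin (2 * n)) : MvPolynomial (Fin n) ℝ :=
  if j.val % 2 = 0 then 1 + MvPolynomial.X ⟨j.val / 2, by omega⟩
  else 1 - MvPolynomial.X ⟨j.val / 2, by omega⟩

open Filter Topology

/-- Positive definiteness is an open condition among symmetric matrices. -/
theorem Matrix.PosDef.eventually_of_tendsto {ι τ : Type*} [Fintype τ] {l : Filter ι}
    {B : ι → Matrix τ τ ℝ} {A : Matrix τ τ ℝ} (hA : A.PosDef) (hB : ∀ i, (B i).IsSymm)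
    (hlim : Tendsto B l (𝓝 A)) : ∀ᶠ i in l, (B i).PosDef := by
  have hcont : Continuous fun z : Matrix τ τ ℝ × (τ → ℝ) => z.2 ⬝ᵥ z.1.mulVec z.2 := by
    fun_prop
  have hev : ∀ᶠ M in 𝓝 A, ∀ v ∈ Metric.sphere (0 : τ → ℝ) 1, 0 < v ⬝ᵥ M.mulVec v := by
    refine (isCompact_sphere (0 : τ → ℝ) 1).eventually_forall_of_forall_eventually ?_
    intro v hv
    have hv0 : v ≠ 0 := by
      rintro rfl
      simp at hv
    have h0 : 0 < v ⬝ᵥ A.mulVec v := by simpa using hA.dotProduct_mulVec_pos hv0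
    exact (hcont.tendsto (A, v)).eventually (lt_mem_nhds h0)
  filter_upwards [hlim.eventually hev] with i hi
  refine Matrix.PosDef.of_dotProduct_mulVec_pos (hB i) fun v hv => ?_
  have hn : 0 < ‖v‖ := norm_pos_iff.2 hv
  have h1 := hi (‖v‖⁻¹ • v) (by simp [norm_smul, hn.ne'])
  rw [Matrix.mulVec_smul, smul_dotProduct, dotProduct_smul, smul_eq_mul, smul_eq_mul] at h1
  have h2 : 0 < ‖v‖⁻¹ := inv_pos.2 hn
  simpa using (mul_pos_iff_of_pos_left h2).1 ((mul_pos_iff_of_pos_left h2).1 h1)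

theorem tendsto_choose_div_choose {ι : Type*} {l : Filter ι} {m k : ι → ℕ} {y : ℝ}
    (hm : Tendsto m l atTop) (hk : Tendsto (fun i => (k i : ℝ) / m i) l (𝓝 y)) (j : ℕ) :
    Tendsto (fun i => ((k i).choose j : ℝ) / (m i).choose j) l (𝓝 (y ^ j)) := by
  have hsucc (a b : ℕ) : (a.choose (b + 1) : ℝ) * (b + 1) = a.choose b * ((a : ℝ) - b) := by
    rcases lt_or_ge a b with h | h
    · simp [Nat.choose_eq_zero_of_lt h, Nat.choose_eq_zero_of_lt (h.trans (Nat.lt_succ_self b))]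
    · rw [← Nat.cast_sub h]
      exact_mod_cast Nat.choose_succ_right_eq a b
  induction j with
  | zero => simpa using tendsto_const_nhds
  | succ j ih =>
    have hmR : Tendsto (fun i => (m i : ℝ)) l atTop := tendsto_natCast_atTop_atTop.comp hm
    have hj : Tendsto (fun i => (j : ℝ) / m i) l (𝓝 0) := hmR.const_div_atTop _
    have hq : Tendsto (fun i => ((k i : ℝ) / m i - j / m i) / (1 - j / m i)) l (𝓝 y) := by
      have h := (hk.sub hj).div ((tendsto_const_nhds (x := (1 : ℝ))).sub hj) (by norm_num)
      rw [sub_zero, sub_zero, div_one] at h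
      exact h
    rw [pow_succ]
    refine (ih.mul hq).congr' ?_
    filter_upwards [hm.eventually_gt_atTop j] with i hi
    have hm0 : (m i : ℝ) ≠ 0 := by
      have : 0 < m i := by omega
      positivity
    have hmj : (m i : ℝ) - j ≠ 0 := by
      have : (j : ℝ) < m i := by exact_mod_cast hi
      linarith
    have hb : (j : ℝ) + 1 ≠ 0 := by positivity
    rw [← mul_div_mul_right ((k i).choose (j + 1) : ℝ) ((m i).choose (j + 1)) hb,
      hsucc, hsucc, mul_div_mul_comm]
    congr 1
    field_simp

theorem pow_eq_sum_choose_div_choose {j m : ℕ} (hjm : j ≤ m) {u w : ℝ} (huw : u + w = 1) :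
    u ^ j = ∑ k ∈ Finset.range (m + 1),
      ((k.choose j : ℝ) / m.choose j) * (m.choose k * u ^ k * w ^ (m - k)) := by
  have hc : (m.choose j : ℝ) ≠ 0 := by exact_mod_cast (Nat.choose_pos hjm).ne'
  have hterm (k : ℕ) (hk : j ≤ k) :
      ((k.choose j : ℝ) / m.choose j) * (m.choose k * u ^ k * w ^ (m - k))
        = (m - j).choose (k - j) * u ^ k * w ^ (m - k) := by
    have h : (m.choose k : ℝ) * k.choose j = m.choose j * (m - j).choose (k - j) := by
      exact_mod_cast Nat.choose_mul hk
    field_simp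
    linear_combination u ^ k * w ^ (m - k) * h
  obtain ⟨r, rfl⟩ := Nat.exists_eq_add_of_le hjm
  rw [add_assoc, Finset.sum_range_add, Finset.sum_eq_zero, zero_add]
  · have : ∀ x ∈ Finset.range (r + 1),
        (((j + x).choose j : ℝ) / (j + r).choose j)
          * ((j + r).choose (j + x) * u ^ (j + x) * w ^ (j + r - (j + x)))
        = u ^ j * (u ^ x * w ^ (r - x) * r.choose x) := by
      intro x _
      rw [hterm _ (by omega), show j + r - (j + x) = r - x by omega,
        show j + r - j = r by omega, show j + x - j = x by omega]
      ring
    rw [Finset.sum_congr rfl this, ← Finset.mul_sum, ← add_pow, huw, one_pow, mul_one]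
  · intro k hk
    simp [Nat.choose_eq_zero_of_lt (Finset.mem_range.1 hk)]

/-- The Bernstein coefficients of `x ^ a` in degree `m` on the interval `[-1, 1]`. -/
noncomputable def bernsteinCoeff (a m k : ℕ) : ℝ :=
  ∑ j ∈ Finset.range (a + 1), (2 ^ j * (-1) ^ (a - j) * a.choose j) *
    ((k.choose j : ℝ) / m.choose j)

/-- The Bernstein basis polynomials on the interval `[-1, 1]`. -/
noncomputable def bernsteinBasis (m k : ℕ) (x : ℝ) : ℝ :=
  m.choose k * ((1 + x) / 2) ^ k * ((1 - x) / 2) ^ (m - k)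

theorem pow_eq_sum_bernsteinBasis {a m : ℕ} (ham : a ≤ m) (x : ℝ) :
    x ^ a = ∑ k ∈ Finset.range (m + 1), bernsteinCoeff a m k * bernsteinBasis m k x := by
  have hx : x = 2 * ((1 + x) / 2) + -1 := by ring
  conv_lhs => rw [hx, add_pow]
  simp only [bernsteinCoeff, Finset.sum_mul]
  rw [Finset.sum_comm]
  refine Finset.sum_congr rfl fun j hj => ?_
  have hjm : j ≤ m := by
    have := Finset.mem_range.1 hj
    omega
  rw [mul_pow, pow_eq_sum_choose_div_choose hjm (u := (1 + x) / 2) (w := (1 - x) / 2)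
    (by ring)]
  simp only [Finset.mul_sum, Finset.sum_mul, bernsteinBasis]
  exact Finset.sum_congr rfl fun k _ => by ring

theorem sum_bernsteinBasis (m : ℕ) (x : ℝ) :
    ∑ k ∈ Finset.range (m + 1), bernsteinBasis m k x = 1 := by
  simpa [bernsteinCoeff] using (pow_eq_sum_bernsteinBasis (Nat.zero_le m) x).symm

theorem tendsto_bernsteinCoeff {ι : Type*} {l : Filter ι} {m k : ι → ℕ} {y : ℝ}
    (hm : Tendsto m l atTop) (hk : Tendsto (fun i => (k i : ℝ) / m i) l (𝓝 y)) (a : ℕ) :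
    Tendsto (fun i => bernsteinCoeff a (m i) (k i)) l (𝓝 ((2 * y - 1) ^ a)) := by
  have hy : (2 * y - 1) ^ a
      = ∑ j ∈ Finset.range (a + 1), (2 ^ j * (-1) ^ (a - j) * a.choose j) * y ^ j := by
    rw [sub_eq_add_neg, add_pow]
    exact Finset.sum_congr rfl fun j _ => by rw [mul_pow]; ring
  rw [hy]
  exact tendsto_finsetSum _ fun j _ => (tendsto_choose_div_choose hm hk j).const_mul _

/-- The coefficients of a polynomial in the tensor product Bernstein basis of degree `m` in each
variable on `[-1, 1] ^ n`. -/
noncomputable def tensorBernsteinCoeff {n : ℕ} (p : MvPolynomial (Fin n) ℝ) (m : ℕ)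
    (k : Fin n → ℕ) : ℝ :=
  ∑ a ∈ p.support, p.coeff a * ∏ s, bernsteinCoeff (a s) m (k s)

/-- The tensor product Bernstein basis. -/
noncomputable def tensorBernsteinBasis {n : ℕ} (m : ℕ) (k : Fin n → ℕ) (x : Fin n → ℝ) : ℝ :=
  ∏ s, bernsteinBasis m (k s) (x s)

theorem eval_eq_sum_tensorBernsteinBasis {n : ℕ} (p : MvPolynomial (Fin n) ℝ) {m : ℕ}
    (hm : p.totalDegree ≤ m) (x : Fin n → ℝ) :
    MvPolynomial.eval x p = ∑ k ∈ Fintype.piFinset fun _ : Fin n => Finset.range (m + 1),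
      tensorBernsteinCoeff p m k * tensorBernsteinBasis m k x := by
  simp only [tensorBernsteinCoeff, Finset.sum_mul]
  rw [MvPolynomial.eval_eq', Finset.sum_comm]
  refine Finset.sum_congr rfl fun a ha => ?_
  have ham (s : Fin n) : a s ≤ m :=
    (Finsupp.le_degree s a).trans ((MvPolynomial.le_totalDegree ha).trans hm)
  rw [Finset.prod_congr rfl fun s _ => pow_eq_sum_bernsteinBasis (ham s) (x s),
    Finset.prod_univ_sum, Finset.mul_sum]
  refine Finset.sum_congr rfl fun k _ => ?_
  rw [Finset.prod_mul_distrib, tensorBernsteinBasis, mul_assoc]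

theorem sum_tensorBernsteinBasis {n : ℕ} (m : ℕ) (x : Fin n → ℝ) :
    ∑ k ∈ Fintype.piFinset fun _ : Fin n => Finset.range (m + 1), tensorBernsteinBasis m k x
      = 1 := by
  simp only [tensorBernsteinBasis]
  rw [← Finset.prod_univ_sum (fun _ : Fin n => Finset.range (m + 1))
    fun s k => bernsteinBasis m k (x s)]
  simp [sum_bernsteinBasis]

theorem tendsto_tensorBernsteinCoeff {n : ℕ} (p : MvPolynomial (Fin n) ℝ) {ι : Type*}
    {l : Filter ι} {m : ι → ℕ} {k : ι → Fin n → ℕ} {y : Fin n → ℝ} (hm : Tendsto m l atTop)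
    (hk : ∀ s, Tendsto (fun i => (k i s : ℝ) / m i) l (𝓝 (y s))) :
    Tendsto (fun i => tensorBernsteinCoeff p (m i) (k i)) l
      (𝓝 (MvPolynomial.eval (fun s => 2 * y s - 1) p)) := by
  rw [MvPolynomial.eval_eq']
  exact tendsto_finsetSum _ fun a _ => Tendsto.const_mul _ <|
    tendsto_finsetProd _ fun s _ => tendsto_bernsteinCoeff hm (hk s) (a s)

/-- The matrix Bernstein coefficients of a matrix polynomial. -/
noncomputable def matrixBernsteinCoeff {n t : ℕ}
    (F : Matrix (Fin t) (Fin t) (MvPolynomial (Fin n) ℝ)) (m : ℕ) (k : Fin n → ℕ) :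
    Matrix (Fin t) (Fin t) ℝ :=
  F.map fun p => tensorBernsteinCoeff p m k

theorem eventually_posDef_matrixBernsteinCoeff {n t : ℕ}
    {F : Matrix (Fin t) (Fin t) (MvPolynomial (Fin n) ℝ)} (hsymm : F.IsSymm)
    (hpos : ∀ x : Fin n → ℝ, (∀ i, x i ∈ Set.Icc (-1 : ℝ) 1) → (matrixEval F x).PosDef) :
    ∀ᶠ m in atTop, ∀ k : Fin n → ℕ, (∀ s, k s ≤ m) → (matrixBernsteinCoeff F m k).PosDef := by
  by_contra hcon
  rw [not_eventually] at hcon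
  push Not at hcon
  obtain ⟨m, hm, hbad⟩ := Filter.exists_seq_forall_of_frequently hcon
  choose k hk hkbad using hbad
  let U : Ultrafilter ℕ := Ultrafilter.of atTop
  have hU : (U : Filter ℕ) ≤ atTop := Ultrafilter.of_le _
  let q : ℕ → Fin n → ℝ := fun i s => (k i s : ℝ) / m i
  have hq : ∀ i, q i ∈ Set.univ.pi fun _ : Fin n => Set.Icc (0 : ℝ) 1 := fun i s _ =>
    ⟨by positivity, div_le_one_of_le₀ (by exact_mod_cast hk i s) (by positivity)⟩
  obtain ⟨y, hy, hlim⟩ := (isCompact_univ_pi fun _ : Fin n =>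
    isCompact_Icc (a := (0 : ℝ)) (b := 1)).ultrafilter_le_nhds
    (U.map q) (by
      rw [le_principal_iff]
      exact Filter.mem_map.2 (Filter.univ_mem' hq))
  have hqy : Tendsto q U (𝓝 y) := hlim
  have hF : (matrixEval F fun s => 2 * y s - 1).PosDef := hpos _ fun s => by
    have := hy s (Set.mem_univ s)
    constructor <;> linarith [this.1, this.2]
  have hev := hF.eventually_of_tendsto (l := (U : Filter ℕ))
    (B := fun i => matrixBernsteinCoeff F (m i) (k i))
    (fun i => Matrix.IsSymm.map hsymm _)
    (tendsto_pi_nhds.2 fun i => tendsto_pi_nhds.2 fun j =>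
      tendsto_tensorBernsteinCoeff (F i j) (hm.mono_left hU) (tendsto_pi_nhds.1 hqy))
  obtain ⟨i, hi⟩ := hev.exists
  exact hkbad i hi

@[to_additive]
theorem prod_fin_even_odd {M : Type*} [CommMonoid M] {n : ℕ} (g : Fin (2 * n) → M) :
    ∏ j, g j = ∏ i : Fin n, g ⟨2 * i, by omega⟩ * g ⟨2 * i + 1, by omega⟩ := by
  induction n with
  | zero => simp
  | succ n ih =>
    have h := ih fun j => g ⟨j, by omega⟩
    rw [Fin.prod_univ_castSucc (n := n)]
    change ∏ j : Fin (2 * n + 1 + 1), g j = _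
    rw [Fin.prod_univ_castSucc, Fin.prod_univ_castSucc, mul_assoc]
    exact congrArg (· * _) h

theorem cubeForm_two_mul {n : ℕ} (i : Fin n) (h : 2 * i.val < 2 * n) :
    cubeForm n ⟨2 * i, h⟩ = 1 + MvPolynomial.X i := by
  simp [cubeForm]

theorem cubeForm_two_mul_add_one {n : ℕ} (i : Fin n) (h : 2 * i.val + 1 < 2 * n) :
    cubeForm n ⟨2 * i + 1, h⟩ = 1 - MvPolynomial.X i := by
  have h1 : (2 * i.val + 1) % 2 = 1 := by omega
  have h2 : (2 * i.val + 1) / 2 = i := by omega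
  simp [cubeForm, h1, h2]

theorem sum_eval_cubeForm {n : ℕ} (x : Fin n → ℝ) :
    ∑ j, MvPolynomial.eval x (cubeForm n j) = 2 * n := by
  rw [sum_fin_even_odd]
  simp only [cubeForm_two_mul, cubeForm_two_mul_add_one, map_add, map_sub, map_one,
    MvPolynomial.eval_X, add_add_sub_cancel]
  simp
  ring

/-- The exponents of `1 + X₁, 1 - X₁, …` in the tensor product Bernstein basis. -/
def pairExponent {n : ℕ} (m : ℕ) (k : Fin n → ℕ) (j : Fin (2 * n)) : ℕ :=
  if j.val % 2 = 0 then k ⟨j.val / 2, by omega⟩ else m - k ⟨j.val / 2, by omega⟩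

theorem pairExponent_two_mul {n : ℕ} (m : ℕ) (k : Fin n → ℕ) (i : Fin n)
    (h : 2 * i.val < 2 * n) : pairExponent m k ⟨2 * i, h⟩ = k i := by
  simp [pairExponent]

theorem pairExponent_two_mul_add_one {n : ℕ} (m : ℕ) (k : Fin n → ℕ) (i : Fin n)
    (h : 2 * i.val + 1 < 2 * n) : pairExponent m k ⟨2 * i + 1, h⟩ = m - k i := by
  have h1 : (2 * i.val + 1) % 2 = 1 := by omega
  have h2 : (2 * i.val + 1) / 2 = i := by omega
  simp [pairExponent, h1, h2]

theorem sum_pairExponent {n m : ℕ} {k : Fin n → ℕ} (hk : ∀ s, k s ≤ m) :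
    ∑ j, pairExponent m k j = m * n := by
  rw [sum_fin_even_odd]
  simp only [pairExponent_two_mul, pairExponent_two_mul_add_one]
  rw [Finset.sum_congr rfl fun i _ => Nat.add_sub_cancel' (hk i)]
  simp [mul_comm]

theorem tensorBernsteinBasis_eq {n m : ℕ} {k : Fin n → ℕ} (hk : ∀ s, k s ≤ m)
    (x : Fin n → ℝ) :
    tensorBernsteinBasis m k x = (∏ s, (m.choose (k s) : ℝ) / 2 ^ m) *
      ∏ j, MvPolynomial.eval x (cubeForm n j) ^ pairExponent m k j := by
  rw [prod_fin_even_odd, ← Finset.prod_mul_distrib, tensorBernsteinBasis]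
  refine Finset.prod_congr rfl fun s _ => ?_
  rw [cubeForm_two_mul, cubeForm_two_mul_add_one, pairExponent_two_mul,
    pairExponent_two_mul_add_one, bernsteinBasis, div_pow, div_pow]
  have h2 : (2 : ℝ) ^ m = 2 ^ k s * 2 ^ (m - k s) := by
    rw [← pow_add, Nat.add_sub_cancel' (hk s)]
  simp only [map_add, map_sub, map_one, MvPolynomial.eval_X, h2]
  field_simp

theorem exists_pos_forall_posSemidef_sub_smul_one {κ τ : Type*} [Fintype τ] [DecidableEq τ]
    (s : Finset κ) {B : κ → Matrix τ τ ℝ} (hB : ∀ k ∈ s, (B k).PosDef) :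
    ∃ ε : ℝ, 0 < ε ∧ ∀ k ∈ s, (B k - ε • (1 : Matrix τ τ ℝ)).PosSemidef := by
  have h : ∀ᶠ ε : ℝ in 𝓝[>] 0, ∀ k ∈ s, (B k - ε • (1 : Matrix τ τ ℝ)).PosDef := by
    refine (Finset.eventually_all s).2 fun k hk => ?_
    refine (hB k hk).eventually_of_tendsto (fun ε => ?_) ?_
    · have hs : (B k).IsSymm := by
        simpa [Matrix.IsHermitian, Matrix.IsSymm] using (hB k hk).isHermitian
      exact hs.sub (Matrix.isSymm_one.smul ε)
    · have hc : Continuous fun ε : ℝ => B k - ε • (1 : Matrix τ τ ℝ) := by fun_prop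
      simpa using (hc.tendsto 0).mono_left nhdsWithin_le_nhds
  obtain ⟨ε, hε, hpos⟩ := (h.and self_mem_nhdsWithin).exists
  exact ⟨ε, hpos, fun k hk => (hε k hk).posSemidef⟩

theorem sum_piAntidiag_mul_sum_fiber {κ ι : Type*} [Fintype ι] [DecidableEq ι] (K : Finset κ)
    (e : κ → ι → ℕ) {M : ℕ} (he : ∀ k ∈ K, ∑ j, e k j = M) (P : (ι → ℕ) → ℝ) (Y : κ → ℝ) :
    ∑ r ∈ Finset.range (M + 1), ∑ α ∈ Finset.piAntidiag (Finset.univ : Finset ι) r,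
      P α * ∑ k ∈ K with e k = α, Y k = ∑ k ∈ K, Y k * P (e k) := by
  have hinner (α : ι → ℕ) :
      P α * ∑ k ∈ K with e k = α, Y k = ∑ k ∈ K with e k = α, Y k * P (e k) := by
    rw [Finset.mul_sum]
    refine Finset.sum_congr rfl fun k hk => ?_
    rw [(Finset.mem_filter.1 hk).2, mul_comm]
  simp only [hinner]
  rw [Finset.sum_range_succ, Finset.sum_eq_zero, zero_add]
  · refine Finset.sum_fiberwise_of_maps_to (fun k hk => ?_) _
    simpa using he k hk
  · intro r hr
    refine Finset.sum_eq_zero fun α hα => ?_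
    rw [Finset.filter_false_of_mem, Finset.sum_empty]
    rintro k hk rfl
    have h1 := he k hk
    have h2 : ∑ j, e k j = r := by simpa using hα
    have := Finset.mem_range.1 hr
    omega

theorem sum_range_sum_piAntidiag_multinomial {ι : Type*} [Fintype ι] [DecidableEq ι] (M : ℕ)
    {c : ℝ} (hc : c ≠ 0) {L : ι → ℝ} (hL : ∑ j, L j = c) :
    ∑ r ∈ Finset.range (M + 1), ∑ α ∈ Finset.piAntidiag (Finset.univ : Finset ι) r,
      (∏ j, L j ^ α j) * ((c ^ ∑ j, α j)⁻¹ * Nat.multinomial Finset.univ α) = M + 1 := by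
  have h (r : ℕ) : ∑ α ∈ Finset.piAntidiag (Finset.univ : Finset ι) r,
      (∏ j, L j ^ α j) * ((c ^ ∑ j, α j)⁻¹ * Nat.multinomial Finset.univ α) = 1 := by
    rw [← inv_mul_cancel₀ (pow_ne_zero r hc)]
    nth_rw 3 [← hL]
    rw [Finset.sum_pow_eq_sum_piAntidiag, Finset.mul_sum]
    refine Finset.sum_congr rfl fun α hα => ?_
    have hα' : ∑ j, α j = r := by simpa using hα
    rw [hα']
    ring
  simp [h]

theorem mainTheorem10 (n t d : ℕ) (ht : 0 < t) (hd : 0 < d)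
    (F : Matrix (Fin t) (Fin t) (MvPolynomial (Fin n) ℝ))
    (hsymm : F.IsSymm) (hdeg : HasMatrixDegree F d)
    (hpos : ∀ x : Fin n → ℝ, (∀ i, x i ∈ Set.Icc (-1 : ℝ) 1) → (matrixEval F x).PosDef) :
    ∃ N : ℕ, 0 < N ∧ ∃ G : (Fin (2 * n) → ℕ) → Matrix (Fin t) (Fin t) ℝ,
      (∀ α : Fin (2 * n) → ℕ, ∑ j, α j ≤ N + d → (G α).PosDef) ∧
      F = ∑ k ∈ Finset.range (N + d + 1),
            ∑ α ∈ Finset.piAntidiag (Finset.univ : Finset (Fin (2 * n))) k,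
              (∏ j, cubeForm n j ^ α j) • (G α).map MvPolynomial.C := by
  have hn : 0 < n := by
    obtain ⟨α, hα, -⟩ := hdeg.2
    rcases Nat.eq_zero_or_pos n with rfl | h
    · simp [Finsupp.degree_eq_sum] at hα
      omega
    · exact h
  obtain ⟨m, hB, hm, hmd⟩ := ((eventually_posDef_matrixBernsteinCoeff hsymm hpos).and
    ((eventually_all.2 fun i => eventually_all.2 fun j =>
      eventually_ge_atTop (F i j).totalDegree).and (eventually_gt_atTop d))).exists
  let K : Finset (Fin n → ℕ) := Fintype.piFinset fun _ => Finset.range (m + 1)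
  have hK : ∀ k ∈ K, ∀ s, k s ≤ m := fun k hk s =>
    Nat.lt_succ_iff.1 (Finset.mem_range.1 (Fintype.mem_piFinset.1 hk s))
  obtain ⟨ε, hε, hBε⟩ := exists_pos_forall_posSemidef_sub_smul_one K fun k hk => hB k (hK k hk)
  have hdM : d < m * n := hmd.trans_le (Nat.le_mul_of_pos_right m hn)
  let c : (Fin n → ℕ) → ℝ := fun k => ∏ s, (m.choose (k s) : ℝ) / 2 ^ m
  let w : (Fin (2 * n) → ℕ) → ℝ := fun α =>
    ((2 * n : ℝ) ^ ∑ j, α j)⁻¹ * Nat.multinomial Finset.univ α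
  let ε' : ℝ := ε / ((m * n : ℕ) + 1)
  refine ⟨m * n - d, by omega, fun α =>
    ∑ k ∈ K with pairExponent m k = α,
      c k • (matrixBernsteinCoeff F m k - ε • (1 : Matrix (Fin t) (Fin t) ℝ))
      + (ε' * w α) • (1 : Matrix (Fin t) (Fin t) ℝ), fun α _ => ?_, ?_⟩
  · refine Matrix.PosDef.posSemidef_add (Matrix.posSemidef_sum _ fun k hk => ?_)
      (Matrix.PosDef.one.smul ?_)
    · exact (hBε k (Finset.mem_filter.1 hk).1).smul (Finset.prod_nonneg fun s _ => by positivity)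
    · have : (0 : ℝ) < Nat.multinomial Finset.univ α := by
        exact_mod_cast Nat.multinomial_pos _ _
      have hnR : (0 : ℝ) < n := by exact_mod_cast hn
      positivity
  · rw [Nat.sub_add_cancel hdM.le]
    ext1 i j
    refine MvPolynomial.funext fun x => ?_
    let L : Fin (2 * n) → ℝ := fun j => MvPolynomial.eval x (cubeForm n j)
    let o : ℝ := (1 : Matrix (Fin t) (Fin t) ℝ) i j
    have hfib := sum_piAntidiag_mul_sum_fiber K (pairExponent m) (M := m * n)
      (fun k hk => sum_pairExponent (hK k hk)) (fun α => ∏ j, L j ^ α j)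
      fun k => c k * (tensorBernsteinCoeff (F i j) m k - ε * o)
    have hone := sum_range_sum_piAntidiag_multinomial (m * n) (L := L) (c := 2 * n)
      (by positivity) (sum_eval_cubeForm x)
    have hεo : ε * o = ∑ k ∈ Fintype.piFinset fun _ : Fin n => Finset.range (m + 1),
        ε * o * tensorBernsteinBasis m k x := by
      rw [← Finset.mul_sum, sum_tensorBernsteinBasis, mul_one]
    have hbasis : ∑ k ∈ K, (c k * (tensorBernsteinCoeff (F i j) m k - ε * o))
        * ∏ j, L j ^ pairExponent m k j = MvPolynomial.eval x (F i j) - ε * o := by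
      conv_rhs => rw [eval_eq_sum_tensorBernsteinBasis (F i j) (hm i j), hεo]
      rw [← Finset.sum_sub_distrib]
      refine Finset.sum_congr rfl fun k hk => ?_
      rw [tensorBernsteinBasis_eq (hK k hk)]
      ring
    have hG (α : Fin (2 * n) → ℕ) :
        MvPolynomial.eval x (((∏ j, cubeForm n j ^ α j) •
          (∑ k ∈ K with pairExponent m k = α,
            c k • (matrixBernsteinCoeff F m k - ε • (1 : Matrix (Fin t) (Fin t) ℝ))
            + (ε' * w α) • (1 : Matrix (Fin t) (Fin t) ℝ)).map MvPolynomial.C) i j)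
        = (∏ j, L j ^ α j) * (∑ k ∈ K with pairExponent m k = α,
            c k * (tensorBernsteinCoeff (F i j) m k - ε * o))
          + ε' * o * ((∏ j, L j ^ α j) * w α) := by
      simp only [Matrix.smul_apply, Matrix.map_apply, Matrix.add_apply, Matrix.sum_apply,
        Matrix.sub_apply, matrixBernsteinCoeff, smul_eq_mul, map_mul, map_prod, map_pow,
        MvPolynomial.eval_C, L, o]
      ring
    simp only [Matrix.sum_apply, map_sum, hG, Finset.sum_add_distrib, ← Finset.mul_sum]
    rw [hfib, hbasis, hone]
    have hM : ((m * n : ℕ) : ℝ) + 1 ≠ 0 := by positivity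
    have hε' : ε' * (((m * n : ℕ) : ℝ) + 1) = ε := div_mul_cancel₀ _ hM
    linear_combination (-o) * hε'
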